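/- Let $(X,d)$ be a compact metric space, $f : X \to X$ a Borel measurable map and $\mu$ an $f$-invariant Borel probability measure on $X$. Let $\mathcal{M}$ be the set of Borel probability measures on $X$, endowed with the Wasserstein distance $W_1(\nu_1,\nu_2) = \sup_{\phi} \int \phi \, d(\nu_1-\nu_2)$, the supremum being over all $1$-Lipschitz functions $\phi : X \to \mathbb{R}$ (it induces the weak-$*$ topology), and let $\mathcal{M}_f \subset \mathcal{M}$ be the subset of $f$-invariant measures. Let $e_f(x) := \lim_{n\to\infty} \frac1n \sum_{k=0}^{n-1} \delta_{f^k(x)}$ be the weak-$*$ limit of the empirical measures; by Birkhoff's theorem it exists for $\mu$-almost every $x \in X$. Let $\mu_{e_f} := (e_f)_* \mu$ be the ergodic decomposition of $\mu$, a Borel probability measure on $\mathcal{M}$. The emergence of $\mu$ at $\epsilon > 0$ is \[ \mathcal{E}_\mu(\epsilon) = \min \Big\{ N \in \mathbb{N} : \exists\, \nu_1,\dots,\nu_N \in \mathcal{M}_f, \ \int_X \min_{1\le i\le N} W_1(e_f(x), \nu_i) \, d\mu(x) \le \epsilon \Big\} \] (where $N \ge 1$), and the emergence order of $\mu$ and the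 local order of its ergodic decomposition at $\nu \in \mathcal{M}$ are \[ \overline{\mathsf{ord}}\, \mathcal{E}_\mu = \limsup_{\epsilon\to 0} \frac{\log\log \mathcal{E}_\mu(\epsilon)}{-\log\epsilon}, \qquad \overline{\mathsf{ord}}\, \mathcal{E}^{\mathrm{loc}}_\mu(\nu) = \limsup_{\epsilon\to 0} \frac{\log\big(-\log \mu_{e_f}(B(\nu,\epsilon))\big)}{-\log\epsilon}, \] both in $[-\infty,+\infty]$ with $\log 0 = -\infty$, $\log(+\infty) = +\infty$, where $B(\nu,\epsilon)$ is the open $W_1$-ball. Then for $\mu_{e_f}$-almost every $\nu \in \mathcal{M}$, \[ \overline{\mathsf{ord}}\, \mathcal{E}^{\mathrm{loc}}_\mu(\nu) \le \overline{\mathsf{ord}}\, \mathcal{E}_\mu . \] -/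

import Mathlib

open MeasureTheory Filter Topology
open scoped ENNReal NNReal

noncomputable section

namespace ErgodicEmergence

variable {X : Type*} [MeasurableSpace X]

/-- The empirical measure `(1 / (n + 1)) ∑_{k < n + 1} δ_{f^k x}` as a probability measure. -/
def empirical (f : X → X) (n : ℕ) (x : X) : ProbabilityMeasure X :=
  ⟨((n + 1 : ℕ) : ℝ≥0∞)⁻¹ • ∑ k ∈ Finset.range (n + 1), Measure.dirac (f^[k] x), ⟨by
    simp only [Measure.smul_apply, Measure.finsetSum_apply, measure_univ, Finset.sum_const,
      Finset.card_range, smul_eq_mul, nsmul_eq_mul, mul_one]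
    exact ENNReal.inv_mul_cancel (by simp) (ENNReal.natCast_ne_top _)⟩⟩

lemma measurable_empirical {f : X → X} (hf : Measurable f) (n : ℕ) :
    Measurable (empirical f n) := by
  refine Measurable.subtype_mk ?_
  refine Measure.measurable_of_measurable_coe _ fun s hs => ?_
  simp only [Measure.smul_apply, Measure.finsetSum_apply, smul_eq_mul]
  refine Measurable.const_mul (Finset.measurable_sum _ fun k _ => ?_) _
  exact (Measure.measurable_coe hs).comp (Measure.measurable_dirac.comp (hf.iterate k))

section Limit

variable [MetricSpace X] [CompactSpace X] [BorelSpace X]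

open Classical in
/-- `e_f(x)`, the weak-* limit of the empirical measures of the orbit of `x`. For every invariant
probability measure the limit exists at almost every point (Birkhoff); at the remaining points,
where it does not exist, the value is irrelevant and is set to `δ_x`. The limit is unique because
the space of probability measures is Hausdorff. -/
def empiricalLimit (f : X → X) (x : X) : ProbabilityMeasure X :=
  if h : ∃ ν : ProbabilityMeasure X, Tendsto (fun n => empirical f n x) atTop (𝓝 ν) then h.choose
  else diracProba x

/-- Weak-* open sets are measurable for the canonical σ-algebra on probability measures. -/
lemma opensMeasurableSpace_probabilityMeasure : OpensMeasurableSpace (ProbabilityMeasure X) := by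
  have : SecondCountableTopology (ProbabilityMeasure X) := by
    let := TopologicalSpace.metrizableSpaceMetric (ProbabilityMeasure X)
    infer_instance
  have hmeas : ∀ φ : BoundedContinuousFunction X ℝ≥0, Measurable
      fun ν : ProbabilityMeasure X => ν.toFiniteMeasure.testAgainstNN φ := fun φ =>
    ((Measure.measurable_lintegral φ.measurable_coe_ennreal_comp).comp
      measurable_subtype_coe).ennreal_toNNReal
  have htop : (inferInstance : TopologicalSpace (ProbabilityMeasure X)) =
      ⨅ φ : BoundedContinuousFunction X ℝ≥0, TopologicalSpace.induced
        (fun ν : ProbabilityMeasure X => ν.toFiniteMeasure.testAgainstNN φ) inferInstance := by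
    refine TopologicalSpace.ext_nhds fun ν => ?_
    rw [nhds_iInf, iInf_congr fun φ : BoundedContinuousFunction X ℝ≥0 => nhds_induced
      (fun ν : ProbabilityMeasure X => ν.toFiniteMeasure.testAgainstNN φ) ν]
    refine le_antisymm (le_iInf fun φ => ?_) ?_
    · exact tendsto_iff_comap.1
        (ProbabilityMeasure.continuous_testAgainstNN_eval φ).continuousAt
    · refine (tendsto_id' (x := ⨅ φ : BoundedContinuousFunction X ℝ≥0, _)).1 ?_
      refine ProbabilityMeasure.tendsto_iff_forall_lintegral_tendsto.2 fun φ => ?_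
      have h := (ENNReal.continuous_coe.tendsto _).comp
        (tendsto_comap.mono_left (iInf_le (fun φ : BoundedContinuousFunction X ℝ≥0 => comap
          (fun ν : ProbabilityMeasure X => ν.toFiniteMeasure.testAgainstNN φ)
          (𝓝 (ν.toFiniteMeasure.testAgainstNN φ))) φ))
      simp only [Function.comp_def, FiniteMeasure.testAgainstNN_coe_eq] at h
      exact h
  rw [← generateFrom_iUnion_isOpen] at htop
  refine ⟨?_⟩
  rw [borel_eq_generateFrom_of_subbasis htop]
  refine MeasurableSpace.generateFrom_le fun s hs => ?_
  obtain ⟨φ, U, hU, rfl⟩ := Set.mem_iUnion.1 hs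
  exact hmeas φ hU.measurableSet

lemma measurable_empiricalLimit {f : X → X} (hf : Measurable f) :
    Measurable (empiricalLimit f) := by
  classical
  have := opensMeasurableSpace_probabilityMeasure (X := X)
  have : SecondCountableTopology (ProbabilityMeasure X) := by
    let := TopologicalSpace.metrizableSpaceMetric (ProbabilityMeasure X)
    infer_instance
  have : TopologicalSpace.IsCompletelyPseudoMetrizableSpace (ProbabilityMeasure X) := by
    let := TopologicalSpace.metrizableSpaceMetric (ProbabilityMeasure X)
    infer_instance
  have hE : MeasurableSet {x | ∃ ν, Tendsto (fun n => empirical f n x) atTop (𝓝 ν)} :=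
    measurableSet_exists_tendsto (measurable_empirical hf)
  set E := {x | ∃ ν, Tendsto (fun n => empirical f n x) atTop (𝓝 ν)} with hEdef
  let g : ℕ → X → ProbabilityMeasure X := fun n x => if x ∈ E then empirical f n x else diracProba x
  have hg : ∀ n, Measurable (g n) := fun n =>
    Measurable.ite hE (measurable_empirical hf n) (Measurable.subtype_mk Measure.measurable_dirac)
  have hlim : ∀ x, Tendsto (fun n => g n x) atTop (𝓝 (empiricalLimit f x)) := fun x => by
    by_cases h : x ∈ E
    · have h' : ∃ ν, Tendsto (fun n => empirical f n x) atTop (𝓝 ν) := h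
      simp only [g, if_pos h, empiricalLimit, dif_pos h']
      exact h'.choose_spec
    · have h' : ¬ ∃ ν, Tendsto (fun n => empirical f n x) atTop (𝓝 ν) := h
      simp only [g, if_neg h, empiricalLimit, dif_neg h']
      exact tendsto_const_nhds
  have hint : ∀ φ : BoundedContinuousFunction X ℝ≥0,
      Measurable fun x => ∫⁻ y, φ y ∂(empiricalLimit f x : Measure X) := fun φ =>
    measurable_of_tendsto_metrizable
      (fun n => (Measure.measurable_lintegral φ.measurable_coe_ennreal_comp).comp
        (measurable_subtype_coe.comp (hg n)))
      (tendsto_pi_nhds.2 fun x =>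
        ProbabilityMeasure.tendsto_iff_forall_lintegral_tendsto.1 (hlim x) φ)
  have hmain : Measurable fun x => (empiricalLimit f x : Measure X) := by
    refine Measurable.measure_of_isPiSystem_of_isProbabilityMeasure
      (S := {s : Set X | IsClosed s}) ?_ isPiSystem_isClosed fun F hF => ?_
    · rw [← borel_eq_generateFrom_isClosed]
      exact BorelSpace.measurable_eq
    · exact measurable_of_tendsto_metrizable (fun n => hint (IsClosed.apprSeq hF n))
        (tendsto_pi_nhds.2 fun x => HasOuterApproxClosed.tendsto_lintegral_apprSeq hF _)
  exact hmain.subtype_mk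

/-- The ergodic decomposition of `μ`: the push-forward of `μ` under `e_f`, a probability measure on
the space of probability measures of `X`. -/
def ergodicDecomposition (f : X → X) (hf : Measurable f) (μ : ProbabilityMeasure X) :
    ProbabilityMeasure (ProbabilityMeasure X) :=
  μ.map (measurable_empiricalLimit hf).aemeasurable

/-- The Wasserstein distance `W₁(ν₁, ν₂) = sup_φ ∫ φ d(ν₁ - ν₂)` over the 1-Lipschitz functions. -/
def W₁ (ν₁ ν₂ : ProbabilityMeasure X) : ℝ≥0∞ :=
  ⨆ φ : {φ : X → ℝ // LipschitzWith 1 φ},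
    ENNReal.ofReal (∫ x, φ.1 x ∂(ν₁ : Measure X) - ∫ x, φ.1 x ∂(ν₂ : Measure X))

/-- The emergence of `μ` at scale `ε`: the least `N` such that some `N` invariant probability
measures are on average `ε`-close to `e_f(x)`. For `N = 0` the distance to the empty family is
`∞`, so that `N = 0` never qualifies. -/
def emergence (f : X → X) (μ : ProbabilityMeasure X) (ε : ℝ) : ℕ∞ :=
  ⨅ (N : ℕ) (_ : ∃ ν : Fin N → ProbabilityMeasure X,
      (∀ i, MeasurePreserving f (ν i : Measure X) (ν i : Measure X)) ∧
      ∫⁻ x, (⨅ i, W₁ (empiricalLimit f x) (ν i)) ∂(μ : Measure X) ≤ ENNReal.ofReal ε), (N : ℕ∞)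

/-- The emergence order `limsup_{ε → 0} log log 𝓔_μ(ε) / (- log ε)`, in `[-∞, ∞]`, with
`log 0 = -∞`. -/
def emergenceOrder (f : X → X) (μ : ProbabilityMeasure X) : EReal :=
  limsup (fun ε : ℝ =>
    ENNReal.log (ENNReal.log (emergence f μ ε : ℝ≥0∞)).toENNReal / ((-Real.log ε : ℝ) : EReal))
    (𝓝[>] 0)

/-- The local order `limsup_{ε → 0} log (- log μ_{e_f}(B(ν, ε))) / (- log ε)` at `ν`, in
`[-∞, ∞]`, with `log 0 = -∞`; `B(ν, ε)` is the open `W₁`-ball. -/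
def localOrder (f : X → X) (hf : Measurable f) (μ ν : ProbabilityMeasure X) : EReal :=
  limsup (fun ε : ℝ =>
    ENNReal.log (-ENNReal.log ((ergodicDecomposition f hf μ : Measure (ProbabilityMeasure X))
      {ν' | W₁ ν ν' < ENNReal.ofReal ε})).toENNReal / ((-Real.log ε : ℝ) : EReal))
    (𝓝[>] 0)

end Limit

end ErgodicEmergence

end

/-!
Emergence only enters through the law `m` of `e_f(x)`, as an upper bound for the quantization
numbers `Q(ε)` of `m`, where `Q(ε)` is the least number of points such that the distance to the
nearest one is on average at most `ε`.

Take `Q(ρ ^ b)` optimal points for `ρ = 2 ^ (-k)` and `b > 1`. By Markov's inequality, all but a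
mass of order `ρ ^ (b - 1)` lies within `ρ / 2` of these points, and the points whose ball of
radius `ρ / 2` has mass less than `ρ / Q(ρ ^ b)` account for at most `ρ` more. Both bounds are
summable in `k`, so by Borel-Cantelli almost every `ν` satisfies `m (B(ν, ρ)) ≥ ρ / Q(ρ ^ b)` for
all large `k`. The factor `ρ` is negligible on the double-logarithmic scale unless the order of
`Q` is negative, so the local order is at most `b` times the order of `Q`; then let `b → 1`.

If the order of `Q` is negative, then `Q ≤ 1` at small scales: `m` is concentrated at a single
point up to distance zero, and the local order is `-∞`.
-/

namespace ErgodicEmergence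

section DoubleLogOrder

/-- The upper double-logarithmic order `limsup_{ε → 0} log log a(ε) / (-log ε)` of a function of the
scale, in `[-∞, ∞]`. Truncating the inner logarithm at `0` gives `log log a = -∞` for `a ≤ 1`. -/
noncomputable def doubleLogOrder (a : ℝ → ℝ≥0∞) : EReal :=
  limsup (fun ε : ℝ =>
    ENNReal.log (ENNReal.log (a ε)).toENNReal / ((-Real.log ε : ℝ) : EReal)) (𝓝[>] 0)

lemma log_log_div_neg_log_le_iff {a : ℝ≥0∞} {ε s : ℝ} (hε : ε ∈ Set.Ioo 0 1) :
    ENNReal.log (ENNReal.log a).toENNReal / ((-Real.log ε : ℝ) : EReal) ≤ s ↔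
      a ≤ ENNReal.ofReal (Real.exp (ε ^ (-s))) := by
  have hlog : 0 < -Real.log ε := neg_pos.2 (Real.log_neg hε.1 hε.2)
  have hpow : 0 < ε ^ (-s) := Real.rpow_pos_of_pos hε.1 _
  have houter : -Real.log ε * s = Real.log (ε ^ (-s)) := by rw [Real.log_rpow hε.1]; ring
  calc _ ↔ ENNReal.log (ENNReal.log a).toENNReal ≤ (Real.log (ε ^ (-s)) : EReal) := by
        rw [EReal.div_le_iff_le_mul (EReal.coe_pos.2 hlog) (EReal.coe_ne_top _), ← EReal.coe_mul,
          houter]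
    _ ↔ (ENNReal.log a).toENNReal ≤ ((ε ^ (-s) : ℝ) : EReal).toENNReal := by
        rw [← ENNReal.log_ofReal_of_pos hpow, ENNReal.log_le_log_iff, EReal.real_coe_toENNReal]
    _ ↔ ENNReal.log a ≤ (ε ^ (-s) : ℝ) :=
        ⟨fun h => not_lt.1 fun hlt =>
          (EReal.toENNReal_lt_toENNReal (EReal.coe_nonneg.2 hpow.le) hlt).not_ge h,
          EReal.toENNReal_le_toENNReal⟩
    _ ↔ _ := by
        rw [← ENNReal.log_le_log_iff, ENNReal.log_ofReal_of_pos (Real.exp_pos _), Real.log_exp]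

lemma eventually_mem_Ioo_nhdsGT_zero : ∀ᶠ ε : ℝ in 𝓝[>] 0, ε ∈ Set.Ioo (0 : ℝ) 1 :=
  Ioo_mem_nhdsGT one_pos

lemma eventually_le_of_doubleLogOrder_lt {a : ℝ → ℝ≥0∞} {s : ℝ} (h : doubleLogOrder a < s) :
    ∀ᶠ ε : ℝ in 𝓝[>] 0, a ε ≤ ENNReal.ofReal (Real.exp (ε ^ (-s))) := by
  filter_upwards [eventually_lt_of_limsup_lt h, eventually_mem_Ioo_nhdsGT_zero] with ε h hε
  exact (log_log_div_neg_log_le_iff hε).1 h.le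

lemma doubleLogOrder_le_of_eventually_le {a : ℝ → ℝ≥0∞} {s : ℝ}
    (h : ∀ᶠ ε : ℝ in 𝓝[>] 0, a ε ≤ ENNReal.ofReal (Real.exp (ε ^ (-s)))) :
    doubleLogOrder a ≤ s := by
  refine limsup_le_of_le (h := ?_)
  filter_upwards [h, eventually_mem_Ioo_nhdsGT_zero] with ε h hε
  exact (log_log_div_neg_log_le_iff hε).2 h

lemma doubleLogOrder_mono {a b : ℝ → ℝ≥0∞} (h : a ≤ b) : doubleLogOrder a ≤ doubleLogOrder b := by
  refine EReal.le_of_forall_lt_iff_le.1 fun s hs => doubleLogOrder_le_of_eventually_le ?_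
  filter_upwards [eventually_le_of_doubleLogOrder_lt hs] with ε hε using (h ε).trans hε

lemma doubleLogOrder_eq_bot {a : ℝ → ℝ≥0∞} (h : ∀ᶠ ε : ℝ in 𝓝[>] 0, a ε ≤ 1) :
    doubleLogOrder a = ⊥ := by
  refine (EReal.eq_bot_iff_forall_lt _).2 fun s => ?_
  refine lt_of_le_of_lt ?_ (EReal.coe_lt_coe_iff.2 (sub_one_lt s))
  refine doubleLogOrder_le_of_eventually_le ?_
  filter_upwards [h, self_mem_nhdsWithin] with ε h hε
  exact h.trans (ENNReal.one_le_ofReal.2 (Real.one_le_exp (Real.rpow_nonneg hε.le _)))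

lemma eventually_lt_two_of_doubleLogOrder_neg {a : ℝ → ℝ≥0∞} (h : doubleLogOrder a < 0) :
    ∀ᶠ ε : ℝ in 𝓝[>] 0, a ε < 2 := by
  obtain ⟨s, has, hs⟩ := EReal.lt_iff_exists_real_btwn.1 h
  have hpow : Tendsto (fun ε : ℝ => Real.exp (ε ^ (-s))) (𝓝[>] 0) (𝓝 1) := by
    have hs' : 0 < -s := neg_pos.2 (EReal.coe_neg'.1 hs)
    have hcont := (Real.continuous_exp.tendsto _).comp
      (Real.continuousAt_rpow_const 0 (-s) (Or.inr hs'.le)).tendsto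
    simp only [Real.zero_rpow hs'.ne', Real.exp_zero] at hcont
    exact hcont.mono_left nhdsWithin_le_nhds
  filter_upwards [eventually_le_of_doubleLogOrder_lt has, hpow.eventually_lt_const one_lt_two]
    with ε haε hε
  exact haε.trans_lt (by simpa using (ENNReal.ofReal_lt_ofReal_iff two_pos).2 hε)

lemma isLittleO_rpow_neg_nhdsGT_zero {c t : ℝ} (h : c < t) :
    (fun ε : ℝ => ε ^ (-c)) =o[𝓝[>] 0] fun ε : ℝ => ε ^ (-t) := by
  have hpow : Tendsto (fun ε : ℝ => ε ^ (t - c)) (𝓝[>] 0) (𝓝 0) := by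
    have hcont := (Real.continuousAt_rpow_const 0 (t - c) (Or.inr (sub_pos.2 h).le)).tendsto
    rw [Real.zero_rpow (sub_pos.2 h).ne'] at hcont
    exact hcont.mono_left nhdsWithin_le_nhds
  refine (Asymptotics.isLittleO_iff_tendsto' ?_).2 (hpow.congr' ?_)
  · filter_upwards [self_mem_nhdsWithin] with ε hε h0
    exact absurd h0 (Real.rpow_pos_of_pos hε _).ne'
  · filter_upwards [self_mem_nhdsWithin] with ε hε
    rw [← Real.rpow_sub hε]
    ring_nf

lemma eventually_div_two_rpow_neg_le {c t : ℝ} (h : c < t) :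
    ∀ᶠ ε : ℝ in 𝓝[>] 0, (ε / 2) ^ (-c) ≤ ε ^ (-t) := by
  have hO := (isLittleO_rpow_neg_nhdsGT_zero h).const_mul_left ((1 / 2) ^ (-c))
  filter_upwards [hO.bound one_pos, self_mem_nhdsWithin] with ε hbound hε
  rw [div_eq_inv_mul, ← one_div, Real.mul_rpow (by norm_num) hε.le]
  rw [one_mul, Real.norm_of_nonneg (Real.rpow_nonneg hε.le _)] at hbound
  exact (le_abs_self _).trans hbound

lemma eventually_rpow_neg_sub_log_le {c t : ℝ} (hct : c < t) (ht : 0 < t) :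
    ∀ᶠ ε : ℝ in 𝓝[>] 0, ε ^ (-c) - Real.log ε ≤ ε ^ (-t) := by
  have hO := (isLittleO_rpow_neg_nhdsGT_zero hct).sub
    (isLittleO_log_rpow_nhdsGT_zero (neg_lt_zero.2 ht))
  filter_upwards [hO.bound one_pos, self_mem_nhdsWithin] with ε hbound hε
  rw [one_mul, Real.norm_of_nonneg (Real.rpow_nonneg hε.le _)] at hbound
  exact (le_abs_self _).trans hbound

lemma tendsto_half_pow_nhdsGT_zero : Tendsto (fun k : ℕ => (1 / 2 : ℝ) ^ k) atTop (𝓝[>] 0) :=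
  tendsto_pow_atTop_nhdsWithin_zero_of_lt_one (by norm_num) (by norm_num)

lemma doubleLogOrder_le_of_eventually_half_pow_le {a : ℝ → ℝ≥0∞} (ha : Antitone a) {c : ℝ}
    (hc : 0 ≤ c) (h : ∀ᶠ k : ℕ in atTop,
      a ((1 / 2) ^ k) ≤ ENNReal.ofReal (Real.exp (((1 / 2) ^ k) ^ (-c)))) :
    doubleLogOrder a ≤ c := by
  refine EReal.le_of_forall_lt_iff_le.1 fun t hct => doubleLogOrder_le_of_eventually_le ?_
  obtain ⟨K, hK⟩ := eventually_atTop.1 h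
  have hsmall : ∀ᶠ ε : ℝ in 𝓝[>] 0, ε < (1 / 2) ^ K :=
    eventually_nhdsWithin_of_eventually_nhds (eventually_lt_nhds (by positivity))
  filter_upwards [hsmall, eventually_mem_Ioo_nhdsGT_zero,
    eventually_div_two_rpow_neg_le (EReal.coe_lt_coe_iff.1 hct)] with ε hεK hε hεt
  obtain ⟨n, hlt, hle⟩ := exists_nat_pow_near_of_lt_one hε.1 hε.2.le
    (one_half_pos (α := ℝ)) one_half_lt_one
  have hKn : K ≤ n + 1 :=
    ((pow_lt_pow_iff_right_of_lt_one₀ one_half_pos one_half_lt_one).1 (hlt.trans hεK)).le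
  calc a ε ≤ a ((1 / 2) ^ (n + 1)) := ha hlt.le
    _ ≤ ENNReal.ofReal (Real.exp (((1 / 2) ^ (n + 1)) ^ (-c))) := hK _ hKn
    _ ≤ ENNReal.ofReal (Real.exp ((ε / 2) ^ (-c))) := by
        refine ENNReal.ofReal_le_ofReal (Real.exp_le_exp.2 ?_)
        refine Real.rpow_le_rpow_of_nonpos (half_pos hε.1) ?_ (neg_nonpos.2 hc)
        rw [pow_succ]
        linarith
    _ ≤ ENNReal.ofReal (Real.exp (ε ^ (-t))) :=
        ENNReal.ofReal_le_ofReal (Real.exp_le_exp.2 hεt)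

end DoubleLogOrder

section Quantization

variable {E : Type*} [PseudoEMetricSpace E] [MeasurableSpace E]

/-- The quantization number of a measure `m` at scale `ε`: the least `N` such that for some
`N` points of `E` the distance to the nearest of them has `m`-average at most `ε`. -/
noncomputable def quantizationNumber (m : Measure E) (ε : ℝ≥0∞) : ℕ∞ :=
  ⨅ (N : ℕ) (_ : ∃ c : Fin N → E, ∫⁻ x, (⨅ i, edist x (c i)) ∂m ≤ ε), (N : ℕ∞)

/-- The quantization order of a measure: the double-logarithmic order of its quantization
numbers. -/
noncomputable def quantizationOrder (m : Measure E) : EReal :=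
  doubleLogOrder fun ε => (quantizationNumber m (ENNReal.ofReal ε) : ℝ≥0∞)

/-- The local order of a measure at a point `x`, which measures how fast the mass of the balls
around `x` decays. The inverse mass is used because `log (m B)⁻¹ = -log (m B)`. -/
noncomputable def ballOrder (m : Measure E) (x : E) : EReal :=
  doubleLogOrder fun ε => (m (Metric.eball x (ENNReal.ofReal ε)))⁻¹

variable {m : Measure E}

lemma exists_centers_of_quantizationNumber_ne_top {ε : ℝ≥0∞} (h : quantizationNumber m ε ≠ ⊤) :
    ∃ (N : ℕ) (c : Fin N → E), (N : ℕ∞) = quantizationNumber m ε ∧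
      ∫⁻ x, (⨅ i, edist x (c i)) ∂m ≤ ε := by
  obtain ⟨N, hN⟩ := iInf_lt_iff.1 ((ENat.lt_add_one_iff h).2 le_rfl)
  obtain ⟨⟨c, hc⟩, hN⟩ := iInf_lt_iff.1 hN
  exact ⟨N, c, ((ENat.lt_add_one_iff h).1 hN).antisymm (iInf₂_le N ⟨c, hc⟩), hc⟩

/-- Outside the `r`-neighbourhood of the centers Markov's inequality applies. Inside, a point near
a center of mass at least `τ / N` has a heavy ball, and the at most `N` lighter centers cover mass
at most `τ`. -/
lemma measure_eball_lt_div_card_le (hd : ∀ y : E, Measurable fun x => edist x y) {N : ℕ}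
    (c : Fin N → E) {r : ℝ≥0∞} (hr : r ≠ 0) (hr' : r ≠ ∞) (τ : ℝ≥0∞) :
    m {x | m (Metric.eball x (2 * r)) < τ / N} ≤ (∫⁻ x, (⨅ i, edist x (c i)) ∂m) / r + τ := by
  classical
  let light : Finset (Fin N) := Finset.univ.filter fun i => m (Metric.eball (c i) r) < τ / N
  have hcover : {x | m (Metric.eball x (2 * r)) < τ / N} ⊆
      {x | r ≤ ⨅ i, edist x (c i)} ∪ ⋃ i ∈ light, Metric.eball (c i) r := fun x hx => by
    rcases le_or_gt r (⨅ i, edist x (c i)) with hfar | hnear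
    · exact Or.inl hfar
    · obtain ⟨i, hi⟩ := iInf_lt_iff.1 hnear
      have hball : Metric.eball (c i) r ⊆ Metric.eball x (2 * r) := fun y hy =>
        (edist_triangle y (c i) x).trans_lt <|
          two_mul r ▸ ENNReal.add_lt_add hy (edist_comm x (c i) ▸ hi)
      exact Or.inr (Set.mem_biUnion
        (Finset.mem_filter.2 ⟨Finset.mem_univ i, (measure_mono hball).trans_lt hx⟩) hi)
  have hfar : m {x | r ≤ ⨅ i, edist x (c i)} ≤ (∫⁻ x, (⨅ i, edist x (c i)) ∂m) / r :=
    meas_ge_le_lintegral_div (Measurable.iInf fun i => hd (c i)).aemeasurable hr hr'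
  have hlight : m (⋃ i ∈ light, Metric.eball (c i) r) ≤ τ :=
    calc m (⋃ i ∈ light, Metric.eball (c i) r) ≤ ∑ i ∈ light, m (Metric.eball (c i) r) :=
          measure_biUnion_finset_le _ _
      _ ≤ ∑ _i ∈ light, τ / N := Finset.sum_le_sum fun i hi => (Finset.mem_filter.1 hi).2.le
      _ ≤ ∑ _i : Fin N, τ / N := Finset.sum_le_sum_of_subset (Finset.subset_univ _)
      _ ≤ τ := by simpa using ENNReal.mul_div_le
  exact (measure_mono hcover).trans ((measure_union_le _ _).trans (add_le_add hfar hlight))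

lemma measure_eball_lt_div_quantizationNumber_le (hd : ∀ y : E, Measurable fun x => edist x y)
    (ε : ℝ≥0∞) {r : ℝ≥0∞} (hr : r ≠ 0) (hr' : r ≠ ∞) (τ : ℝ≥0∞) :
    m {x | m (Metric.eball x (2 * r)) < τ / (quantizationNumber m ε : ℝ≥0∞)} ≤ ε / r + τ := by
  by_cases htop : quantizationNumber m ε = ⊤
  · simp [htop]
  · obtain ⟨N, c, hN, hc⟩ := exists_centers_of_quantizationNumber_ne_top htop
    rw [← hN, ENat.toENNReal_coe]
    exact (measure_eball_lt_div_card_le hd c hr hr' τ).trans (by gcongr)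

lemma ae_eventually_div_quantizationNumber_le (hd : ∀ y : E, Measurable fun x => edist x y)
    {b : ℝ} (hb : 1 < b) :
    ∀ᵐ x ∂m, ∀ᶠ k : ℕ in atTop, ENNReal.ofReal ((1 / 2) ^ k) /
        (quantizationNumber m (ENNReal.ofReal (((1 / 2) ^ k) ^ b)) : ℝ≥0∞) ≤
      m (Metric.eball x (ENNReal.ofReal ((1 / 2) ^ k))) := by
  have hbound : ∀ k : ℕ, m {x | m (Metric.eball x (ENNReal.ofReal ((1 / 2) ^ k))) <
      ENNReal.ofReal ((1 / 2) ^ k) /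
        (quantizationNumber m (ENNReal.ofReal (((1 / 2) ^ k) ^ b)) : ℝ≥0∞)} ≤
      ENNReal.ofReal (2 * ((1 / 2) ^ (b - 1)) ^ k + (1 / 2) ^ k) := fun k => by
    have hρ : (0 : ℝ) < (1 / 2) ^ k := by positivity
    have hdouble : 2 * ENNReal.ofReal ((1 / 2) ^ k / 2) = ENNReal.ofReal ((1 / 2) ^ k) := by
      rw [← ENNReal.ofReal_ofNat, ← ENNReal.ofReal_mul two_pos.le, mul_div_cancel₀ _ two_ne_zero]
    have hpow : ((1 / 2 : ℝ) ^ k) ^ b / ((1 / 2) ^ k / 2) = 2 * ((1 / 2) ^ (b - 1)) ^ k := by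
      rw [← Real.rpow_natCast (_ ^ (b - 1)), ← Real.rpow_mul (by norm_num), mul_comm (b - 1),
        Real.rpow_mul (by norm_num), Real.rpow_natCast, Real.rpow_sub_one hρ.ne']
      field_simp
    have h := measure_eball_lt_div_quantizationNumber_le (m := m) hd
      (ENNReal.ofReal (((1 / 2) ^ k) ^ b)) (ENNReal.ofReal_pos.2 (half_pos hρ)).ne'
      ENNReal.ofReal_ne_top (ENNReal.ofReal ((1 / 2) ^ k))
    rwa [hdouble, ← ENNReal.ofReal_div_of_pos (half_pos hρ), hpow,
      ← ENNReal.ofReal_add (by positivity) hρ.le] at h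
  have hsum : Summable fun k : ℕ => 2 * ((1 / 2 : ℝ) ^ (b - 1)) ^ k + (1 / 2) ^ k :=
    ((summable_geometric_of_lt_one (by positivity)
      (Real.rpow_lt_one (by norm_num) (by norm_num) (sub_pos.2 hb))).mul_left 2).add
      summable_geometric_two
  filter_upwards [ae_eventually_notMem
    (ne_top_of_le_ne_top hsum.tsum_ofReal_ne_top (ENNReal.tsum_le_tsum hbound))] with x hx
  exact hx.mono fun k hk => not_lt.1 hk

lemma ballOrder_le_mul {x : E} {b s : ℝ} (hb : 0 < b) (hs : 0 < s)
    (hx : ∀ᶠ k : ℕ in atTop, ENNReal.ofReal ((1 / 2) ^ k) /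
        (quantizationNumber m (ENNReal.ofReal (((1 / 2) ^ k) ^ b)) : ℝ≥0∞) ≤
      m (Metric.eball x (ENNReal.ofReal ((1 / 2) ^ k))))
    (hms : quantizationOrder m < s) : ballOrder m x ≤ (b * s : ℝ) := by
  have hanti : Antitone fun ε => (m (Metric.eball x (ENNReal.ofReal ε)))⁻¹ := fun ε₁ ε₂ h =>
    ENNReal.inv_le_inv.2 (measure_mono (Metric.eball_subset_eball (ENNReal.ofReal_le_ofReal h)))
  refine EReal.le_of_forall_lt_iff_le.1 fun t ht => ?_
  replace ht : b * s < t := EReal.coe_lt_coe_iff.1 ht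
  have ht0 : 0 < t := (mul_pos hb hs).trans ht
  refine doubleLogOrder_le_of_eventually_half_pow_le hanti ht0.le ?_
  have hscale : Tendsto (fun k : ℕ => ((1 / 2 : ℝ) ^ k) ^ b) atTop (𝓝[>] 0) := by
    refine tendsto_nhdsWithin_iff.2 ⟨?_, Eventually.of_forall fun k => by
      simpa only [Set.mem_Ioi] using Real.rpow_pos_of_pos (by positivity) b⟩
    have hcont := (Real.continuousAt_rpow_const 0 b (Or.inr hb.le)).tendsto
    rw [Real.zero_rpow hb.ne'] at hcont
    exact hcont.comp (tendsto_nhdsWithin_iff.1 tendsto_half_pow_nhdsGT_zero).1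
  filter_upwards [hx, hscale.eventually (eventually_le_of_doubleLogOrder_lt hms),
    tendsto_half_pow_nhdsGT_zero.eventually (eventually_rpow_neg_sub_log_le ht ht0)]
    with k hball hQ hreal
  set ρ : ℝ := (1 / 2) ^ k with hρ_def
  have hρ : 0 < ρ := by positivity
  rw [← Real.rpow_mul hρ.le, mul_neg] at hQ
  refine ENNReal.inv_le_iff_inv_le.1 (le_trans ?_ hball)
  rw [← ENNReal.ofReal_inv_of_pos (Real.exp_pos _), ← Real.exp_neg]
  calc ENNReal.ofReal (Real.exp (-ρ ^ (-t)))
      ≤ ENNReal.ofReal (ρ / Real.exp (ρ ^ (-(b * s)))) := by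
        refine ENNReal.ofReal_le_ofReal ?_
        rw [← Real.exp_log hρ, ← Real.exp_sub, Real.exp_log hρ]
        exact Real.exp_le_exp.2 (by linarith)
    _ = ENNReal.ofReal ρ / ENNReal.ofReal (Real.exp (ρ ^ (-(b * s)))) :=
        ENNReal.ofReal_div_of_pos (Real.exp_pos _)
    _ ≤ _ := by gcongr

lemma ae_ballOrder_le_quantizationOrder_of_nonneg
    (hd : ∀ y : E, Measurable fun x => edist x y) (h : 0 ≤ quantizationOrder m) :
    ∀ᵐ x ∂m, ballOrder m x ≤ quantizationOrder m := by
  have hmass := ae_all_iff.2 fun n : ℕ => ae_eventually_div_quantizationNumber_le (m := m) hd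
    (b := 1 + 1 / (n + 1)) (lt_add_of_pos_right 1 Nat.one_div_pos_of_nat)
  filter_upwards [hmass] with x hx
  refine EReal.le_of_forall_lt_iff_le.1 fun s hs => ?_
  have hs0 : 0 < s := EReal.coe_pos.1 (h.trans_lt hs)
  have hlim : Tendsto (fun n : ℕ => (1 + 1 / (n + 1) : ℝ) * s) atTop (𝓝 s) := by
    simpa using (tendsto_one_div_add_atTop_nhds_zero_nat.const_add (1 : ℝ)).mul_const s
  exact ge_of_tendsto' (EReal.tendsto_coe.2 hlim) fun n =>
    ballOrder_le_mul (by positivity) hs0 (hx n) hs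

lemma exists_lintegral_edist_le_of_quantizationNumber_lt_two [NeZero m] {ε : ℝ≥0∞}
    (hε : ε ≠ ∞) (h : quantizationNumber m ε < 2) : ∃ c : E, ∫⁻ x, edist x c ∂m ≤ ε := by
  obtain ⟨N, c, hN, hc⟩ := exists_centers_of_quantizationNumber_ne_top h.ne_top
  rw [← hN] at h
  have hN2 : N < 2 := by exact_mod_cast h
  interval_cases N
  · have hinfinite : ∫⁻ x, (⨅ i, edist x (c i)) ∂m = ∞ := by
      simp only [iInf_of_empty, lintegral_const,
        ENNReal.top_mul (Measure.measure_univ_ne_zero.2 (NeZero.ne m))]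
    exact absurd (top_le_iff.1 (hinfinite ▸ hc)) hε
  · exact ⟨c 0, by simpa [iInf_unique] using hc⟩

lemma ae_ae_edist_eq_zero (hd : ∀ y : E, Measurable fun x => edist x y)
    (h : ∀ ε > 0, ∃ c : E, ∫⁻ x, edist x c ∂m ≤ ε) : ∀ᵐ x ∂m, ∀ᵐ y ∂m, edist x y = 0 := by
  choose c hc using h
  obtain ⟨δ, hδ, hδsum⟩ := ENNReal.exists_pos_sum_of_countable' one_ne_zero ℕ
  have hsum : ∫⁻ x, ∑' n, edist x (c (δ n) (hδ n)) ∂m ≠ ∞ := by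
    rw [lintegral_tsum fun n => (hd _).aemeasurable]
    exact ne_top_of_le_ne_top (hδsum.trans ENNReal.one_lt_top).ne
      (ENNReal.tsum_le_tsum fun n => hc _ _)
  have hconv : ∀ᵐ x ∂m, Tendsto (fun n => edist x (c (δ n) (hδ n))) atTop (𝓝 0) := by
    filter_upwards [ae_lt_top (Measurable.tsum fun n => hd _) hsum] with x hx
    exact ENNReal.tendsto_atTop_zero_of_tsum_ne_top hx.ne
  filter_upwards [hconv] with x hx
  filter_upwards [hconv] with y hy
  refine le_antisymm (ge_of_tendsto' (by simpa using hx.add hy) fun n => ?_) zero_le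
  exact edist_triangle_right x y _

lemma ae_ballOrder_eq_bot [IsProbabilityMeasure m] (hd : ∀ y : E, Measurable fun x => edist x y)
    (h : quantizationOrder m < 0) : ∀ᵐ x ∂m, ballOrder m x = ⊥ := by
  have hcenter : ∀ ε > 0, ∃ c : E, ∫⁻ x, edist x c ∂m ≤ ε := fun ε hε => by
    have hsmall : ∀ᶠ δ : ℝ in 𝓝[>] 0, ENNReal.ofReal δ < ε := by
      refine Tendsto.eventually_lt_const hε (ENNReal.ofReal_zero ▸ ?_)
      exact (ENNReal.continuous_ofReal.tendsto 0).mono_left nhdsWithin_le_nhds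
    obtain ⟨δ, hδ, hQ⟩ := (hsmall.and (eventually_lt_two_of_doubleLogOrder_neg h)).exists
    obtain ⟨c, hc⟩ := exists_lintegral_edist_le_of_quantizationNumber_lt_two
      ENNReal.ofReal_ne_top (ENat.toENNReal_lt.1 hQ)
    exact ⟨c, hc.trans hδ.le⟩
  filter_upwards [ae_ae_edist_eq_zero hd hcenter] with x hx
  refine doubleLogOrder_eq_bot ?_
  filter_upwards [self_mem_nhdsWithin] with ε hε
  have hball : m (Metric.eball x (ENNReal.ofReal ε)) = 1 := by
    rw [← measure_univ (μ := m)]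
    refine measure_congr (eventuallyEq_univ.2 (hx.mono fun y hy => ?_))
    exact Metric.mem_eball'.2 (hy ▸ ENNReal.ofReal_pos.2 hε)
  rw [hball, inv_one]

end Quantization

section Wasserstein

variable {X : Type*} [MeasurableSpace X] [MetricSpace X]

lemma W₁_self (ν : ProbabilityMeasure X) : W₁ ν ν = 0 := by
  simp only [W₁, sub_self, ENNReal.ofReal_zero, ENNReal.iSup_zero]

lemma W₁_le_W₁_swap (ν₁ ν₂ : ProbabilityMeasure X) : W₁ ν₁ ν₂ ≤ W₁ ν₂ ν₁ := by
  refine iSup_le fun φ => le_iSup_of_le ⟨-φ.1, φ.2.neg⟩ (le_of_eq ?_)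
  simp only [Pi.neg_apply, integral_neg, neg_sub_neg]

lemma W₁_comm (ν₁ ν₂ : ProbabilityMeasure X) : W₁ ν₁ ν₂ = W₁ ν₂ ν₁ :=
  (W₁_le_W₁_swap ν₁ ν₂).antisymm (W₁_le_W₁_swap ν₂ ν₁)

lemma ofReal_integral_sub_le_W₁ (ν₁ ν₂ : ProbabilityMeasure X) {φ : X → ℝ}
    (hφ : LipschitzWith 1 φ) :
    ENNReal.ofReal (∫ x, φ x ∂(ν₁ : Measure X) - ∫ x, φ x ∂(ν₂ : Measure X)) ≤ W₁ ν₁ ν₂ :=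
  le_iSup (fun φ : {φ : X → ℝ // LipschitzWith 1 φ} =>
    ENNReal.ofReal (∫ x, φ.1 x ∂(ν₁ : Measure X) - ∫ x, φ.1 x ∂(ν₂ : Measure X))) ⟨φ, hφ⟩

lemma W₁_triangle (ν₁ ν₂ ν₃ : ProbabilityMeasure X) : W₁ ν₁ ν₃ ≤ W₁ ν₁ ν₂ + W₁ ν₂ ν₃ := by
  refine iSup_le fun ⟨φ, hφ⟩ => ?_
  rw [← sub_add_sub_cancel _ (∫ x, φ x ∂(ν₂ : Measure X))]
  exact ENNReal.ofReal_add_le.trans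
    (add_le_add (ofReal_integral_sub_le_W₁ ν₁ ν₂ hφ) (ofReal_integral_sub_le_W₁ ν₂ ν₃ hφ))

/-- The Wasserstein distance as an extended pseudometric. It is not a global instance, because its
topology is not definitionally the weak-* topology of `ProbabilityMeasure X`. -/
noncomputable abbrev wassersteinPseudoEMetricSpace : PseudoEMetricSpace (ProbabilityMeasure X) where
  edist := W₁
  edist_self := W₁_self
  edist_comm := W₁_comm
  edist_triangle := W₁_triangle

variable [BorelSpace X] [CompactSpace X]

lemma measurable_W₁_left (ν₂ : ProbabilityMeasure X) : Measurable fun ν₁ => W₁ ν₁ ν₂ := by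
  have := opensMeasurableSpace_probabilityMeasure (X := X)
  refine LowerSemicontinuous.measurable (lowerSemicontinuous_iSup fun φ => ?_)
  refine Continuous.lowerSemicontinuous (ENNReal.continuous_ofReal.comp ?_)
  exact (ProbabilityMeasure.continuous_integral_boundedContinuousFunction
    (BoundedContinuousFunction.mkOfCompact ⟨φ.1, φ.2.continuous⟩)).sub continuous_const

attribute [local instance] wassersteinPseudoEMetricSpace

variable {f : X → X} (hf : Measurable f) (μ : ProbabilityMeasure X)

lemma quantizationNumber_ergodicDecomposition_le_emergence (ε : ℝ) :
    quantizationNumber (ergodicDecomposition f hf μ : Measure (ProbabilityMeasure X))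
      (ENNReal.ofReal ε) ≤ emergence f μ ε := by
  refine le_iInf₂ fun N ⟨c, _, hc⟩ => iInf₂_le N ⟨c, le_trans ?_ hc⟩
  exact lintegral_map_le _ _

lemma quantizationOrder_ergodicDecomposition_le_emergenceOrder :
    quantizationOrder (ergodicDecomposition f hf μ : Measure (ProbabilityMeasure X)) ≤
      emergenceOrder f μ :=
  doubleLogOrder_mono fun ε =>
    ENat.toENNReal_le.2 (quantizationNumber_ergodicDecomposition_le_emergence hf μ ε)

lemma localOrder_eq_ballOrder (ν : ProbabilityMeasure X) :
    localOrder f hf μ ν =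
      ballOrder (ergodicDecomposition f hf μ : Measure (ProbabilityMeasure X)) ν := by
  have hball : ∀ r : ℝ≥0∞, Metric.eball ν r = {ν' | W₁ ν ν' < r} := fun r =>
    Set.ext fun ν' => Metric.mem_eball'
  simp only [localOrder, ballOrder, doubleLogOrder, ENNReal.log_inv, hball]

end Wasserstein

end ErgodicEmergence

theorem mainTheorem5_general {E : Type*} [PseudoEMetricSpace E] [MeasurableSpace E]
    (hd : ∀ y : E, Measurable fun x => edist x y) (m : Measure E) [IsProbabilityMeasure m] :
    ∀ᵐ x ∂m, ErgodicEmergence.ballOrder m x ≤ ErgodicEmergence.quantizationOrder m := by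
  rcases lt_or_ge (ErgodicEmergence.quantizationOrder m) 0 with hneg | hnonneg
  · filter_upwards [ErgodicEmergence.ae_ballOrder_eq_bot hd hneg] with x hx using hx ▸ bot_le
  · exact ErgodicEmergence.ae_ballOrder_le_quantizationOrder_of_nonneg hd hnonneg

theorem mainTheorem5 {X : Type*} [MetricSpace X] [CompactSpace X] [MeasurableSpace X] [BorelSpace X]
    (f : X → X) (hf : Measurable f) (μ : ProbabilityMeasure X)
    (hμ : MeasurePreserving f (μ : Measure X) (μ : Measure X)) :
    ∀ᵐ ν ∂(ErgodicEmergence.ergodicDecomposition f hf μ : Measure (ProbabilityMeasure X)),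
      ErgodicEmergence.localOrder f hf μ ν ≤ ErgodicEmergence.emergenceOrder f μ := by
  let := ErgodicEmergence.wassersteinPseudoEMetricSpace (X := X)
  filter_upwards [mainTheorem5_general ErgodicEmergence.measurable_W₁_left
    (ErgodicEmergence.ergodicDecomposition f hf μ : Measure (ProbabilityMeasure X))] with ν hν
  exact (ErgodicEmergence.localOrder_eq_ballOrder hf μ ν).trans_le
    (hν.trans (ErgodicEmergence.quantizationOrder_ergodicDecomposition_le_emergenceOrder hf μ))
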